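/- Fix $w>0$ and $Q>1$. A satellite emits i.i.d. symbols $R_i\in\{+w,-w\}$, each value with probability $1/2$, and $X_i=R_i+N_{A,i}$, $Y_i=R_i+N_{B,i}$, $Z_i=R_i+N_{E,i}$, where the noises are independent of each other and of the $R_i$, i.i.d. over $i$, zero-mean Gaussian with variances $Q$, $Q$ and $1$, respectively. Alice observes the one-bit quantized sequence $X_q^n$ with $X_{q,i}=w\cdot\operatorname{sgn}(X_i)$, Bob observes $Y_q^n$ with $Y_{q,i}=w\cdot\operatorname{sgn}(Y_i)$, and Eve observes the unquantized sequence $Z^n$. In $\ell\ge 1$ rounds of public discussion, Alice and Bob alternately send public messages $F_1,\dots,F_{2\ell}$ (without any constraint on their alphabets), Alice drawing $F_{2k-1}$ according to some $P_{F_{2k-1}\mid X_q^n,F^{2k-2}}$ and Bob drawing $F_{2k}$ according to some $P_{F_{2k}\mid Y_q^n,F^{2k-1}}$. Then Alice generates (possibly with local randomness) a key $K_A$ with values in a finite set $\mathcal K$ from $(X_q^n,F^{2\ell})$ and Bob generates a key $K_B\in\mathcal K$ from $(Y_q^n,F^{2\ell})$. A rate $S$ is achievable for $(w,Q)$ if for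 every $\delta>0$ there are $n\ge1$, $\ell\ge 1$, a finite key alphabet $\mathcal K$ and such a protocol with $S=\log(|\mathcal K|)/n$ and $$\Pr[K_A\ne K_B]\le\delta,\qquad H(K_A)\ge nS-\delta,\qquad I(K_A;F^{2\ell},Z^n)\le\delta .$$ For $\mathcal W\subseteq\mathbb R^+$ let $S_{\mathcal W}(Q)$ be the supremum of all rates that are achievable for $(w,Q)$ for some $w\in\mathcal W$. Then for every non-empty bounded set $\mathcal W\subseteq\mathbb R^+=(0,\infty)$ we have $S_{\mathcal W}(Q)=O(1/Q^2)$ as $Q\to\infty$: there are constants $C>0$ and $Q_0>1$, depending only on $\mathcal W$, such that $S_{\mathcal W}(Q)\le C/Q^2$ for all $Q\ge Q_0$. -/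

import Mathlib

open MeasureTheory ProbabilityTheory
open scoped ENNReal

noncomputable section

namespace SecretKey

/-! ### Information measures (natural logarithm) -/

/-- Shannon entropy of a probability measure on a finite set. -/
def entropy {κ : Type} [Fintype κ] [MeasurableSpace κ] (μ : Measure κ) : ℝ :=
  ∑ k, Real.negMulLog (μ.real {k})

/-- Mutual information `I(U; V)` of a pair `(U, V)` with joint law `μ`: the Kullback-Leibler
divergence between the joint law and the product of its marginals. -/
def mutualInfo {A B : Type} [MeasurableSpace A] [MeasurableSpace B] (μ : Measure (A × B)) : ℝ≥0∞ :=
  InformationTheory.klDiv μ (μ.fst.prod μ.snd)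

/-! ### Secret-key agreement by public discussion -/

/-- A secret-key agreement protocol for blocklength `n` and `l` rounds of public discussion, with
key alphabet `Fin m`. Alice observes `X^n` with values in `Fin n → α`, Bob `Y^n` with values in
`Fin n → β`. The public messages take values in a measurable space `M` that is arbitrary (so that
there is no constraint on the public communication; messages with different alphabets are messages
in their disjoint union).

With `j` messages already exchanged, the next message is drawn by Alice from
`encA j : P(· | X^n, F^j)` if `j` is even and by Bob from `encB j : P(· | Y^n, F^j)` if `j` is odd
(the other kernels are never used). After `2 * l` messages Alice draws her key from
`keyA : P(· | X^n, F^{2l})` and Bob draws his key from `keyB : P(· | Y^n, F^{2l})`; deterministic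
key maps are the special case of deterministic kernels. -/
structure Protocol (α β : Type) [MeasurableSpace α] [MeasurableSpace β] (n l m : ℕ) where
  M : Type
  [measM : MeasurableSpace M]
  encA : (j : ℕ) → Kernel ((Fin n → α) × (Fin j → M)) M
  encB : (j : ℕ) → Kernel ((Fin n → β) × (Fin j → M)) M
  keyA : Kernel ((Fin n → α) × (Fin (2 * l) → M)) (Fin m)
  keyB : Kernel ((Fin n → β) × (Fin (2 * l) → M)) (Fin m)
  [markovA : ∀ j, IsMarkovKernel (encA j)]
  [markovB : ∀ j, IsMarkovKernel (encB j)]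
  [markovKeyA : IsMarkovKernel keyA]
  [markovKeyB : IsMarkovKernel keyB]

attribute [instance] Protocol.measM Protocol.markovA Protocol.markovB Protocol.markovKeyA
  Protocol.markovKeyB

namespace Protocol

variable {α β γ : Type} [MeasurableSpace α] [MeasurableSpace β] [MeasurableSpace γ] {n l m : ℕ}

/-- Conditional law of the message number `j + 1` given both observations and the first `j`
messages: Alice and Bob alternate, Alice begins, and each uses only her or his own observation
and the previous public messages. -/
def next (p : Protocol α β n l m) (j : ℕ) :
    Kernel (((Fin n → α) × (Fin n → β)) × (Fin j → p.M)) p.M :=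
  if Even j then (p.encA j).comap (fun t => (t.1.1, t.2)) (by fun_prop)
  else (p.encB j).comap (fun t => (t.1.2, t.2)) (by fun_prop)

instance (p : Protocol α β n l m) (j : ℕ) : IsMarkovKernel (p.next j) := by
  unfold next
  split_ifs <;> infer_instance

/-- Conditional law of the first `j` public messages `F^j` given `(X^n, Y^n)`. The measurable
equivalence appends the new message at the end of the list of the earlier ones. -/
def transcript (p : Protocol α β n l m) :
    (j : ℕ) → Kernel ((Fin n → α) × (Fin n → β)) (Fin j → p.M)
  | 0 => Kernel.const _ (Measure.dirac Fin.elim0)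
  | j + 1 => (p.transcript j ⊗ₖ p.next j).map
      (fun t => (MeasurableEquiv.piFinSuccAbove (fun _ => p.M) (Fin.last j)).symm (t.2, t.1))

instance (p : Protocol α β n l m) (j : ℕ) : IsMarkovKernel (p.transcript j) := by
  induction j with
  | zero => unfold transcript; infer_instance
  | succ j ih =>
    unfold transcript
    exact Kernel.IsMarkovKernel.map _
      ((MeasurableEquiv.measurable _).comp measurable_swap)

/-- The joint law of `((X^n, Y^n, Z^n), F^{2l}, (K_A, K_B))` when the triples `(X_i, Y_i, Z_i)` are
i.i.d. with law `P`. -/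
def joint (p : Protocol α β n l m) (P : Measure (α × β × γ)) [SigmaFinite P] :
    Measure (((Fin n → α × β × γ) × (Fin (2 * l) → p.M)) × (Fin m × Fin m)) :=
  ((Measure.pi fun _ : Fin n => P) ⊗ₘ
    (p.transcript (2 * l)).comap
      (fun s : Fin n → α × β × γ => (fun i => (s i).1, fun i => (s i).2.1)) (by fun_prop)) ⊗ₘ
  ((p.keyA.comap (fun t : (Fin n → α × β × γ) × (Fin (2 * l) → p.M) =>
        (fun i => (t.1 i).1, t.2)) (by fun_prop)) ×ₖ
    (p.keyB.comap (fun t : (Fin n → α × β × γ) × (Fin (2 * l) → p.M) =>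
        (fun i => (t.1 i).2.1, t.2)) (by fun_prop)))

/-- The law of Alice's key `K_A`. -/
def lawKeyA (p : Protocol α β n l m) (P : Measure (α × β × γ)) [SigmaFinite P] :
    Measure (Fin m) :=
  (p.joint P).map fun t => t.2.1

/-- The joint law of Alice's key and everything Eve sees, `(K_A, (F^{2l}, Z^n))`. -/
def lawKeyAEve (p : Protocol α β n l m) (P : Measure (α × β × γ)) [SigmaFinite P] :
    Measure (Fin m × (Fin (2 * l) → p.M) × (Fin n → γ)) :=
  (p.joint P).map fun t => (t.2.1, t.1.2, fun i => (t.1.1 i).2.2)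

end Protocol

/-- The rate `S` (in nats per symbol) is an achievable strong secret-key rate for the memoryless
source `(X, Y, Z) ∼ P`, where Alice observes `X^n`, Bob `Y^n` and Eve `Z^n`. -/
def IsAchievable {α β γ : Type} [MeasurableSpace α] [MeasurableSpace β] [MeasurableSpace γ]
    (P : Measure (α × β × γ)) [SigmaFinite P] (S : ℝ) : Prop :=
  ∀ δ : ℝ, 0 < δ → ∃ (n l m : ℕ) (p : Protocol α β n l m), 1 ≤ n ∧ 1 ≤ l ∧
    S = Real.log m / n ∧
    p.joint P {t | t.2.1 ≠ t.2.2} ≤ ENNReal.ofReal δ ∧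
    entropy (p.lawKeyA P) ≥ n * S - δ ∧
    mutualInfo (p.lawKeyAEve P) ≤ ENNReal.ofReal δ

/-- The secret-key capacity of the memoryless source `P`: the supremum of all achievable rates
(achievable rates are nonnegative). -/
def capacity {α β γ : Type} [MeasurableSpace α] [MeasurableSpace β] [MeasurableSpace γ]
    (P : Measure (α × β × γ)) [SigmaFinite P] : ℝ≥0∞ :=
  ⨆ (S : ℝ) (_ : IsAchievable P S), ENNReal.ofReal S

/-! ### The satellite source -/

/-- One-bit uniform quantizer `w * sgn x`, with values in `{-w, w}`; the value at `x = 0` (an event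
of probability zero below) is `w`. -/
def quantize (w x : ℝ) : ℝ := if x < 0 then -w else w

/-- Law of the satellite output: `R = w` or `R = -w`, each with probability `1 / 2`. -/
def satelliteLaw (w : ℝ) : Measure ℝ :=
  (2⁻¹ : ℝ≥0∞) • Measure.dirac w + (2⁻¹ : ℝ≥0∞) • Measure.dirac (-w)

/-- Law of `(R, (N_A, N_B, N_E))`: the satellite output and the independent Gaussian noises, with
variance `Q` for Alice and for Bob and variance `1` for Eve. -/
def inputLaw (w Q : ℝ) : Measure (ℝ × ℝ × ℝ × ℝ) :=
  (satelliteLaw w).prod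
    ((gaussianReal 0 Q.toNNReal).prod ((gaussianReal 0 Q.toNNReal).prod (gaussianReal 0 1)))

/-- Law of `(X_q, Y_q, Z)`: the one-bit quantizations of `X = R + N_A` and `Y = R + N_B`, and the
unquantized observation `Z = R + N_E` of Eve. -/
def satelliteSource (w Q : ℝ) : Measure (ℝ × ℝ × ℝ) :=
  (inputLaw w Q).map fun t =>
    (quantize w (t.1 + t.2.1), quantize w (t.1 + t.2.2.1), t.1 + t.2.2.2)

lemma measurable_quantize (w : ℝ) : Measurable (quantize w) :=
  Measurable.ite measurableSet_Iio measurable_const measurable_const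

instance (w : ℝ) : IsProbabilityMeasure (satelliteLaw w) :=
  ⟨by simp [satelliteLaw, ENNReal.inv_two_add_inv_two]⟩

instance (w Q : ℝ) : IsProbabilityMeasure (inputLaw w Q) := by
  unfold inputLaw; infer_instance

instance (w Q : ℝ) : IsProbabilityMeasure (satelliteSource w Q) :=
  Measure.isProbabilityMeasure_map (by
    have := measurable_quantize w
    fun_prop)

/-- The secret-key capacity with a helpful satellite, with one-bit quantization at Alice and Bob and
no quantization at Eve, for the set `W` of admissible amplitudes and the channel quality ratio
`Q`. -/
def satelliteCapacity (W : Set ℝ) (Q : ℝ) : ℝ≥0∞ :=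
  ⨆ w ∈ W, capacity (satelliteSource w Q)

end SecretKey

end

/-!
The capacity is bounded by the mutual information `I(X_q; Y_q)` of the observations of Alice and Bob
alone; that Eve also observes `Z^n` plays no role. The correlation coefficient `ρ` of `X_q` and `Y_q` is
the square of a Gaussian probability of an interval of length `2 * w`, so that `ρ ≤ w ^ 2 / Q`, and
`I(X_q; Y_q) ≤ ρ ^ 2 ≤ w ^ 4 / Q ^ 2`, uniformly over bounded sets of amplitudes.

The bound of the rate by `I(X; Y)` (`IsAchievable.le_integral_log`) is a change of measure to
independent `X^n` and `Y^n` with the same marginals. Under the changed measure the public messages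
keep `X^n` and `Y^n` conditionally independent (`Protocol.condIndepLaw_transcript`), so the keys are
conditionally independent given the messages, say with `a` the conditional law of Alice's key. Bob's
key gives a guess `W` of Alice's key, and `W / a` has mean at most about `1` under the changed
measure. By Jensen's inequality the mean of `log W - log a` under the true law is at most
`n * I(X; Y)`, up to a small error (`Protocol.exists_log_le`). The mean of `log W` is almost `0`,
because the keys agree with high probability, and the mean of `- log a` is almost the entropy of the
key, because the key is almost independent of the messages (`integral_log_add_entropy_le`). This
needs no regularity of the message space: only the observations are disintegrated, and these take
values in standard Borel spaces.
-/

open MeasureTheory ProbabilityTheory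
open scoped ENNReal

noncomputable section

namespace SecretKey

/-! ### Conditional independence given the public messages -/

section CondIndep

variable {X Y T M : Type*} [MeasurableSpace X] [MeasurableSpace Y] [MeasurableSpace T]
  [MeasurableSpace M]

lemma measurable_lintegral_kernel (κ : Kernel X Y) [IsSFiniteKernel κ] {g : T → X}
    (hg : Measurable g) {f : T × Y → ℝ≥0∞} (hf : Measurable f) :
    Measurable fun t => ∫⁻ y, f (t, y) ∂κ (g t) :=
  Measurable.lintegral_kernel_prod_right' (κ := κ.comap g hg) hf

/-- A law `ρ` of `((x, y), t)` under which `x` and `y` are independent conditionally on `t`. It is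
encoded by a disintegration over `t` (`T` need not be standard Borel), with `ν` the law of `t`, and
`κ` and `η` the conditional laws of `x` and of `y`. -/
def CondIndepLaw (ρ : Measure ((X × Y) × T)) : Prop :=
  ∃ (ν : Measure T) (κ : Kernel T X) (η : Kernel T Y),
    IsProbabilityMeasure ν ∧ IsMarkovKernel κ ∧ IsMarkovKernel η ∧
      ∀ f : (X × Y) × T → ℝ≥0∞, Measurable f →
        ∫⁻ z, f z ∂ρ = ∫⁻ t, ∫⁻ x, ∫⁻ y, f ((x, y), t) ∂η t ∂κ t ∂ν

lemma CondIndepLaw.map_equiv {T' : Type*} [MeasurableSpace T'] {ρ : Measure ((X × Y) × T)}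
    (h : CondIndepLaw ρ) (e : T ≃ᵐ T') : CondIndepLaw (ρ.map (Prod.map id e)) := by
  obtain ⟨ν, κ, η, _, _, _, h⟩ := h
  refine ⟨ν.map e, κ.comap e.symm e.symm.measurable, η.comap e.symm e.symm.measurable,
    Measure.isProbabilityMeasure_map e.measurable.aemeasurable, inferInstance, inferInstance,
    fun f hf => ?_⟩
  rw [lintegral_map hf (by fun_prop), h _ (by fun_prop), lintegral_map_equiv]
  simp [Kernel.comap_apply]

lemma CondIndepLaw.map_swap {ρ : Measure ((X × Y) × T)} (h : CondIndepLaw ρ) :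
    CondIndepLaw (ρ.map (Prod.map Prod.swap id)) := by
  obtain ⟨ν, κ, η, _, _, _, h⟩ := h
  refine ⟨ν, η, κ, inferInstance, inferInstance, inferInstance, fun f hf => ?_⟩
  rw [lintegral_map hf (by fun_prop), h _ (by fun_prop)]
  refine lintegral_congr fun t => ?_
  rw [lintegral_lintegral_swap]
  · rfl
  · exact Measurable.aemeasurable (by fun_prop)

/-- Conditional independence given the public messages survives a further message computed from
`x` and the earlier messages: the new conditional law of `x` is obtained by disintegration, and the
one of `y` does not change. -/
lemma CondIndepLaw.extend_left [StandardBorelSpace X] [Nonempty X] {ρ : Measure ((X × Y) × T)}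
    [SFinite ρ] (h : CondIndepLaw ρ) (e : Kernel (X × T) M) [IsMarkovKernel e] :
    CondIndepLaw ((ρ ⊗ₘ e.comap (fun z : (X × Y) × T => (z.1.1, z.2)) (by fun_prop)).map
      (fun z => (z.1.1, (z.1.2, z.2)))) := by
  obtain ⟨ν, κ, η, _, _, _, h⟩ := h
  set ρ' : Measure ((T × M) × X) :=
    ((ν ⊗ₘ κ) ⊗ₘ e.comap Prod.swap measurable_swap).map (fun z => ((z.1.1, z.2), z.1.2)) with hρ'
  have : IsProbabilityMeasure ρ' := Measure.isProbabilityMeasure_map (by fun_prop)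
  refine ⟨ρ'.fst, ρ'.condKernel, η.comap Prod.fst measurable_fst, inferInstance, inferInstance,
    inferInstance, fun f hf => ?_⟩
  have hg : Measurable fun z : (T × M) × X => ∫⁻ y, f ((z.2, y), z.1) ∂η z.1.1 :=
    measurable_lintegral_kernel η (g := fun z : (T × M) × X => z.1.1) (by fun_prop)
      (f := fun p : ((T × M) × X) × Y => f ((p.1.2, p.2), p.1.1)) (by fun_prop)
  have hi : Measurable fun z : (X × Y) × T => ∫⁻ m, f (z.1, (z.2, m)) ∂e (z.1.1, z.2) :=
    measurable_lintegral_kernel e (g := fun z : (X × Y) × T => (z.1.1, z.2)) (by fun_prop)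
      (f := fun p : ((X × Y) × T) × M => f (p.1.1, (p.1.2, p.2))) (by fun_prop)
  have hg' : Measurable fun z : (T × X) × M => ∫⁻ y, f ((z.1.2, y), (z.1.1, z.2)) ∂η z.1.1 :=
    hg.comp (f := fun z : (T × X) × M => ((z.1.1, z.2), z.1.2)) (by fun_prop)
  have hj : Measurable fun z : T × X =>
      ∫⁻ m, ∫⁻ y, f ((z.2, y), (z.1, m)) ∂η z.1 ∂e (z.2, z.1) :=
    measurable_lintegral_kernel e (g := Prod.swap) measurable_swap hg'
  calc ∫⁻ z, f z ∂_ = ∫⁻ t, ∫⁻ x, ∫⁻ y, ∫⁻ m, f ((x, y), (t, m)) ∂e (x, t) ∂η t ∂κ t ∂ν := by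
        rw [lintegral_map hf (by fun_prop), Measure.lintegral_compProd (by fun_prop)]
        exact h _ hi
    _ = ∫⁻ t, ∫⁻ x, ∫⁻ m, ∫⁻ y, f ((x, y), (t, m)) ∂η t ∂e (x, t) ∂κ t ∂ν := by
        refine lintegral_congr fun t => lintegral_congr fun x => lintegral_lintegral_swap ?_
        exact Measurable.aemeasurable (by fun_prop)
    _ = ∫⁻ z, ∫⁻ y, f ((z.2, y), z.1) ∂η z.1.1 ∂ρ' := by
        rw [hρ', lintegral_map hg (by fun_prop), Measure.lintegral_compProd hg',
          Measure.lintegral_compProd (f := fun z : T × X => ∫⁻ m, _ ∂e.comap Prod.swap _ z) hj]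
        rfl
    _ = _ := by
        conv_lhs => rw [← ρ'.disintegrate ρ'.condKernel, Measure.lintegral_compProd hg]
        rfl

/-- The mirror image of `CondIndepLaw.extend_left`: the further message is computed from `y`. -/
lemma CondIndepLaw.extend_right [StandardBorelSpace Y] [Nonempty Y] {ρ : Measure ((X × Y) × T)}
    [SFinite ρ] (h : CondIndepLaw ρ) (e : Kernel (Y × T) M) [IsMarkovKernel e] :
    CondIndepLaw ((ρ ⊗ₘ e.comap (fun z : (X × Y) × T => (z.1.2, z.2)) (by fun_prop)).map
      (fun z => (z.1.1, (z.1.2, z.2)))) := by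
  convert (h.map_swap.extend_left e).map_swap using 1
  refine Measure.ext_of_lintegral _ fun f hf => ?_
  have hi : Measurable fun z : (Y × X) × T => ∫⁻ m, f (z.1.swap, (z.2, m)) ∂e (z.1.1, z.2) :=
    measurable_lintegral_kernel e (g := fun z : (Y × X) × T => (z.1.1, z.2)) (by fun_prop)
      (f := fun p : ((Y × X) × T) × M => f (p.1.1.swap, (p.1.2, p.2)))
      (by fun_prop)
  rw [Measure.map_map (by fun_prop) (by fun_prop), lintegral_map hf (by fun_prop),
    lintegral_map hf (by fun_prop), Measure.lintegral_compProd (by fun_prop),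
    Measure.lintegral_compProd]
  · exact (lintegral_map (f := fun z : (Y × X) × T => ∫⁻ m, f (z.1.swap, (z.2, m)) ∂e (z.1.1, z.2))
      (g := Prod.map Prod.swap id) hi (by fun_prop)).symm
  · fun_prop

end CondIndep

namespace Protocol

variable {α β : Type} [MeasurableSpace α] [MeasurableSpace β] {n l m : ℕ}

/-- Public discussion does not correlate independent observations: if `X^n` and `Y^n` are
independent, then they are independent conditionally on the messages. -/
lemma condIndepLaw_transcript [StandardBorelSpace α] [Nonempty α] [StandardBorelSpace β]
    [Nonempty β] (p : Protocol α β n l m) (μ : Measure (Fin n → α)) (ν : Measure (Fin n → β))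
    [IsProbabilityMeasure μ] [IsProbabilityMeasure ν] (j : ℕ) :
    CondIndepLaw (μ.prod ν ⊗ₘ p.transcript j) := by
  induction j with
  | zero =>
    refine ⟨Measure.dirac Fin.elim0, Kernel.const _ μ, Kernel.const _ ν, inferInstance,
      inferInstance, inferInstance, fun f hf => ?_⟩
    have hg : Measurable fun t : Fin 0 → p.M => ∫⁻ x, ∫⁻ y, f ((x, y), t) ∂ν ∂μ := by fun_prop
    rw [Measure.lintegral_compProd hf, lintegral_prod _
      (measurable_lintegral_kernel (p.transcript 0) (g := fun z => z) measurable_id hf).aemeasurable]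
    simp only [transcript, Kernel.const_apply]
    rw [lintegral_dirac' _ hg]
    refine lintegral_congr fun x => lintegral_congr fun y => ?_
    rw [lintegral_dirac' _ (by fun_prop)]
  | succ j ih =>
    have key : CondIndepLaw (((μ.prod ν ⊗ₘ p.transcript j) ⊗ₘ p.next j).map
        (fun z => (z.1.1, (z.1.2, z.2)))) := by
      unfold next
      split_ifs
      · exact ih.extend_left (p.encA j)
      · exact ih.extend_right (p.encB j)
    convert key.map_equiv (MeasurableEquiv.prodComm.trans
      (MeasurableEquiv.piFinSuccAbove (fun _ => p.M) (Fin.last j)).symm) using 1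
    refine Measure.ext_of_lintegral _ fun f hf => ?_
    rw [Measure.map_map (by fun_prop) (by fun_prop), lintegral_map hf (by fun_prop),
      Measure.lintegral_compProd hf, Measure.lintegral_compProd (by fun_prop),
      Measure.lintegral_compProd (by fun_prop)]
    refine lintegral_congr fun z => ?_
    have hφ : Measurable fun t : (Fin j → p.M) × p.M =>
        (MeasurableEquiv.piFinSuccAbove (fun _ => p.M) (Fin.last j)).symm (t.2, t.1) := by fun_prop
    rw [transcript, Kernel.map_apply _ hφ, lintegral_map (by fun_prop) hφ,
      Kernel.lintegral_compProd _ _ _ (by fun_prop)]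
    rfl

end Protocol

/-! ### Entropy and mutual information -/

/-- One half of the Donsker-Varadhan variational formula, for a bounded test function. -/
lemma integral_le_of_klDiv_le {Ω : Type*} [MeasurableSpace Ω] {μ ν : Measure Ω}
    [IsProbabilityMeasure μ] [IsProbabilityMeasure ν] {δ : ℝ} (hδ : 0 ≤ δ)
    (hkl : InformationTheory.klDiv μ ν ≤ ENNReal.ofReal δ) {g : Ω → ℝ} (hg : Measurable g)
    {B : ℝ} (hB : ∀ x, |g x| ≤ B) (hexp : ∫ x, Real.exp (g x) ∂ν ≤ 1) :
    ∫ x, g x ∂μ ≤ δ := by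
  obtain ⟨hac, hint⟩ := InformationTheory.klDiv_ne_top_iff.1 (hkl.trans_lt ENNReal.ofReal_lt_top).ne
  have hgμ : Integrable g μ := .of_bound hg.aestronglyMeasurable B (.of_forall hB)
  have hgν : Integrable (fun x => Real.exp (g x)) ν := by
    refine .of_bound hg.exp.aestronglyMeasurable (Real.exp B) (.of_forall fun x => ?_)
    rw [Real.norm_of_nonneg (Real.exp_nonneg _)]
    exact Real.exp_le_exp.2 ((le_abs_self _).trans (hB x))
  have := isProbabilityMeasure_tilted hgν
  have h0 := InformationTheory.integral_llr_add_sub_measure_univ_nonneg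
    (hac.trans (absolutelyContinuous_tilted hgν)) (integrable_llr_tilted_right hac hgμ hint hgν)
  rw [integral_llr_tilted_right hac hgμ hgν hint] at h0
  have h1 := InformationTheory.toReal_klDiv hac hint
  have h2 := ENNReal.toReal_le_of_le_ofReal hδ hkl
  have h3 : Real.log (∫ x, Real.exp (g x) ∂ν) ≤ 0 :=
    Real.log_nonpos (integral_nonneg fun x => Real.exp_nonneg _) hexp
  simp only [probReal_univ] at h0 h1
  linarith

lemma entropy_eq_neg_integral_log {κ : Type} [Fintype κ] [MeasurableSpace κ]
    [MeasurableSingletonClass κ] (μ : Measure κ) [IsProbabilityMeasure μ] :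
    entropy μ = -∫ k, Real.log (μ.real {k}) ∂μ := by
  rw [integral_fintype .of_finite, entropy, ← Finset.sum_neg_distrib]
  simp [Real.negMulLog]

/-- If the key `K` is almost independent of `V`, then no conditional (sub-)probability mass function
`a(· | V)` describes `K` with a code length substantially shorter than the entropy of `K`. -/
lemma integral_log_add_entropy_le {V : Type} [MeasurableSpace V] {m : ℕ}
    (μ : Measure (Fin m × V)) [IsProbabilityMeasure μ] {δ : ℝ} (hδ : 0 ≤ δ)
    (hI : mutualInfo μ ≤ ENNReal.ofReal δ) {a : Fin m × V → ℝ} (ha : Measurable a) {c : ℝ}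
    (hc : 0 < c) (hca : ∀ z, c ≤ a z) (hsum : ∀ v, ∑ k, a (k, v) ≤ 1) :
    ∫ z, Real.log (a z) ∂μ + entropy μ.fst ≤ δ := by
  have ha0 : ∀ z, 0 < a z := fun z => hc.trans_le (hca z)
  have ha1 : ∀ z, a z ≤ 1 := fun z =>
    (Finset.single_le_sum (f := fun k => a (k, z.2)) (fun k _ => (ha0 _).le)
      (Finset.mem_univ z.1)).trans (hsum z.2)
  have hlog : ∀ z, |Real.log (a z)| ≤ -Real.log c := fun z => by
    rw [abs_of_nonpos (Real.log_nonpos (ha0 z).le (ha1 z))]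
    exact neg_le_neg (Real.log_le_log hc (hca z))
  set q : Fin m → ℝ := fun k => μ.fst.real {k} with hq
  have hql : ∀ k, |Real.log (q k)| ≤ ∑ k, |Real.log (q k)| := fun k =>
    Finset.single_le_sum (f := fun k => |Real.log (q k)|) (fun k _ => abs_nonneg _)
      (Finset.mem_univ k)
  have hqm : Measurable fun z : Fin m × V => Real.log (q z.1) :=
    (Measurable.of_discrete (f := fun k => Real.log (q k))).comp measurable_fst
  have hexp : ∫ z, Real.exp (Real.log (a z) - Real.log (q z.1)) ∂(μ.fst.prod μ.snd) ≤ 1 := by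
    have hbd : ∀ z, |Real.exp (Real.log (a z) - Real.log (q z.1))| ≤
        Real.exp (∑ k, |Real.log (q k)|) := fun z => by
      rw [abs_of_nonneg (Real.exp_nonneg _), Real.exp_le_exp]
      have := Real.log_nonpos (ha0 z).le (ha1 z)
      have := (neg_le_abs _).trans (hql z.1)
      linarith
    have hi : Integrable (fun z : Fin m × V => Real.exp (Real.log (a z) - Real.log (q z.1)))
        (μ.fst.prod μ.snd) :=
      .of_bound (ha.log.sub hqm).exp.aestronglyMeasurable _ (.of_forall hbd)
    rw [integral_prod_symm _ hi]
    have hv : ∀ v, ∫ k, Real.exp (Real.log (a (k, v)) - Real.log (q k)) ∂μ.fst ≤ 1 := fun v => by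
      rw [integral_fintype .of_finite]
      refine (Finset.sum_le_sum fun k _ => ?_).trans (hsum v)
      rw [smul_eq_mul]
      change q k * _ ≤ _
      -- A key value of probability `0` has `log 0 = 0`, but carries no weight.
      rcases (measureReal_nonneg : 0 ≤ q k).eq_or_lt with h | h
      · exact (mul_eq_zero_of_left h.symm _).trans_le (ha0 _).le
      · rw [Real.exp_sub, Real.exp_log (ha0 _), Real.exp_log h, mul_div_cancel₀ _ h.ne']
    refine (integral_mono hi.integral_prod_right (integrable_const 1) hv).trans ?_
    simp
  have key := integral_le_of_klDiv_le hδ hI (ha.log.sub hqm)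
    (fun z => (abs_sub _ _).trans (add_le_add (hlog z) (hql z.1))) hexp
  simp only [Pi.sub_apply] at key
  rw [integral_sub (.of_bound ha.log.aestronglyMeasurable _ (.of_forall hlog))
    (.of_bound hqm.aestronglyMeasurable _ (.of_forall fun z => hql z.1))] at key
  rw [entropy_eq_neg_integral_log, Measure.fst, integral_map (by fun_prop)
    Measurable.of_discrete.aestronglyMeasurable, ← sub_eq_add_neg]
  exact key

/-! ### Change of measure to independent observations -/

lemma lintegral_pi_prod {n : ℕ} {E : Type*} [MeasurableSpace E] (μ : Measure E)
    [IsProbabilityMeasure μ] {f : Fin n → E → ℝ≥0∞} (hf : ∀ i, Measurable (f i)) :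
    ∫⁻ x, ∏ i, f i (x i) ∂(Measure.pi fun _ : Fin n => μ) = ∏ i, ∫⁻ x, f i x ∂μ := by
  have hind : iIndepFun (fun i (x : Fin n → E) => f i (x i)) (Measure.pi fun _ : Fin n => μ) :=
    iIndepFun_pi fun i => (hf i).aemeasurable
  rw [lintegral_prod_eq_prod_lintegral_of_indepFun _ _ hind
    fun i => (hf i).comp (measurable_pi_apply i)]
  refine Finset.prod_congr rfl fun i _ => ?_
  exact (measurePreserving_eval (fun _ : Fin n => μ) i).lintegral_comp (hf i)

lemma pi_withDensity {n : ℕ} {E : Type*} [MeasurableSpace E] (μ : Measure E)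
    [IsProbabilityMeasure μ] {f : E → ℝ≥0∞} (hf : Measurable f) [SigmaFinite (μ.withDensity f)] :
    Measure.pi (fun _ : Fin n => μ.withDensity f) =
      (Measure.pi fun _ : Fin n => μ).withDensity fun x => ∏ i, f (x i) := by
  refine Measure.pi_eq fun s hs => ?_
  rw [withDensity_apply _ (.univ_pi hs), ← lintegral_indicator (.univ_pi hs)]
  have hi : ∀ i, μ.withDensity f (s i) = ∫⁻ x, (s i).indicator f x ∂μ := fun i => by
    rw [withDensity_apply f (hs i), lintegral_indicator (hs i)]
  simp_rw [hi]
  rw [← lintegral_pi_prod μ fun i => hf.indicator (hs i)]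
  refine lintegral_congr fun x => ?_
  by_cases hx : x ∈ Set.univ.pi s
  · rw [Set.indicator_of_mem hx]
    exact Finset.prod_congr rfl fun i _ => (Set.indicator_of_mem (hx i trivial) _).symm
  · rw [Set.indicator_of_notMem hx]
    obtain ⟨i, hi⟩ : ∃ i, x i ∉ s i := by simpa using hx
    exact (Finset.prod_eq_zero (Finset.mem_univ i) (Set.indicator_of_notMem hi _)).symm

/-- Change of measure from the source `(X^n, Y^n)` to independent `X^n` and `Y^n` with the marginals
`μ` and `ν`, when the single-letter law has density `h` with respect to `μ.prod ν`. -/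
lemma lintegral_div_density {α β γ : Type} [MeasurableSpace α] [MeasurableSpace β]
    [MeasurableSpace γ] {n : ℕ} (P : Measure (α × β × γ)) [IsProbabilityMeasure P]
    (μ : Measure α) (ν : Measure β) [IsProbabilityMeasure μ] [IsProbabilityMeasure ν]
    {h : α × β → ℝ} (hh : Measurable h) (hpos : ∀ z, 0 < h z)
    (hP : P.map (fun t => (t.1, t.2.1)) = (μ.prod ν).withDensity fun z => ENNReal.ofReal (h z))
    {φ : (Fin n → α) × (Fin n → β) → ℝ≥0∞} (hφ : Measurable φ) :
    ∫⁻ s, φ (fun i => (s i).1, fun i => (s i).2.1) *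
        (∏ i, ENNReal.ofReal (h ((s i).1, (s i).2.1)))⁻¹ ∂(Measure.pi fun _ : Fin n => P) =
      ∫⁻ z, φ z ∂((Measure.pi fun _ : Fin n => μ).prod (Measure.pi fun _ : Fin n => ν)) := by
  have : IsProbabilityMeasure (P.map fun t => (t.1, t.2.1)) :=
    Measure.isProbabilityMeasure_map (by fun_prop)
  have hpi := Measure.pi_map_pi (μ := fun _ : Fin n => P) (f := fun _ t => (t.1, t.2.1))
    (fun _ => by fun_prop)
  have hw : IsProbabilityMeasure ((μ.prod ν).withDensity fun z => ENNReal.ofReal (h z)) := hP ▸ this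
  have hpi' : (Measure.pi fun _ : Fin n => P).map (fun s i => ((s i).1, (s i).2.1)) =
      (Measure.pi fun _ : Fin n => μ.prod ν).withDensity fun x => ∏ i, ENNReal.ofReal (h (x i)) := by
    rw [← pi_withDensity (f := fun z => ENNReal.ofReal (h z)) _ (by fun_prop), hpi]
    simp_rw [hP]
  have hd : Measurable fun x : Fin n → α × β => ∏ i, ENNReal.ofReal (h (x i)) := by fun_prop
  have he := (measurePreserving_arrowProdEquivProdArrow α β (Fin n) (fun _ => μ) fun _ => ν)
  rw [← he.map_eq, lintegral_map hφ (by fun_prop)]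
  calc _ = ∫⁻ x, φ (MeasurableEquiv.arrowProdEquivProdArrow α β (Fin n) x) *
          (∏ i, ENNReal.ofReal (h (x i)))⁻¹
        ∂((Measure.pi fun _ : Fin n => P).map (fun s i => ((s i).1, (s i).2.1))) := by
        rw [lintegral_map (by fun_prop) (by fun_prop)]
        rfl
    _ = _ := by
        rw [hpi', lintegral_withDensity_eq_lintegral_mul _ hd (by fun_prop)]
        refine lintegral_congr fun x => ?_
        have h0 : ∏ i, ENNReal.ofReal (h (x i)) ≠ 0 := by
          simp [Finset.prod_eq_zero_iff, hpos]
        have ht : ∏ i, ENNReal.ofReal (h (x i)) ≠ ∞ :=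
          ENNReal.prod_ne_top fun i _ => ENNReal.ofReal_ne_top
        rw [Pi.mul_apply, mul_comm, mul_assoc, ENNReal.inv_mul_cancel h0 ht, mul_one]

/-! ### Keys from independent observations and the Fano-type inequality -/

/-- Jensen's inequality for the logarithm. -/
lemma integral_log_le_of_lintegral_le {Ω : Type*} [MeasurableSpace Ω] {μ : Measure Ω}
    [IsProbabilityMeasure μ] {u : Ω → ℝ} (hum : Measurable u) (hu0 : ∀ x, 0 < u x)
    (hlog : Integrable (fun x => Real.log (u x)) μ) {r : ℝ} (hr : 0 < r)
    (hu : ∫⁻ x, ENNReal.ofReal (u x) ∂μ ≤ ENNReal.ofReal r⁻¹) :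
    ∫ x, Real.log (u x) ∂μ ≤ -Real.log r := by
  have hui : Integrable u μ := by
    refine ⟨hum.aestronglyMeasurable, ?_⟩
    rw [hasFiniteIntegral_iff_ofReal (.of_forall fun t => (hu0 t).le)]
    exact hu.trans_lt ENNReal.ofReal_lt_top
  have hui1 : ∫ t, u t ∂μ ≤ r⁻¹ := by
    rw [integral_eq_lintegral_of_nonneg_ae (.of_forall fun t => (hu0 t).le)
      hum.aestronglyMeasurable]
    exact ENNReal.toReal_le_of_le_ofReal (inv_pos.2 hr).le hu
  calc ∫ x, Real.log (u x) ∂μ ≤ ∫ x, (r * u x - (1 + Real.log r)) ∂μ := by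
        refine integral_mono hlog ((hui.const_mul _).sub (integrable_const _)) fun t => ?_
        have h1 := Real.log_le_sub_one_of_pos (mul_pos hr (hu0 t))
        rw [Real.log_mul hr.ne' (hu0 t).ne'] at h1
        linarith
    _ ≤ _ := by
        rw [integral_sub (hui.const_mul _) (integrable_const _), integral_const_mul]
        simp only [integral_const, probReal_univ, one_smul]
        have h3 : r * ∫ t, u t ∂μ ≤ 1 :=
          (mul_le_mul_of_nonneg_left hui1 hr.le).trans (mul_inv_cancel₀ hr.ne').le
        linarith

/-- The estimate behind Fano's inequality: a guess that gives the truth probability at least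
`1 - ε`, except on the error event `s`, where it still gives it at least `η`. -/
lemma log_add_le_integral_log {Ω : Type*} [MeasurableSpace Ω] {μ : Measure Ω}
    [IsProbabilityMeasure μ] {s : Set Ω} (hs : MeasurableSet s) {ε η : ℝ} (hε : 0 < ε)
    (hε1 : ε < 1) (hη : 0 < η) (hη1 : η ≤ 1) (hμs : μ s ≤ ENNReal.ofReal ε) {w : Ω → ℝ}
    (hw : Integrable (fun x => Real.log (w x)) μ) (hηw : ∀ x, η ≤ w x)
    (hsw : ∀ x ∉ s, 1 - ε ≤ w x) :
    Real.log (1 - ε) + ε * Real.log η ≤ ∫ x, Real.log (w x) ∂μ := by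
  have hε' : 0 < 1 - ε := by linarith
  have hreal : μ.real s ≤ ε := ENNReal.toReal_le_of_le_ofReal hε.le hμs
  calc _ ≤ ∫ x, (Real.log (1 - ε) + s.indicator (fun _ => Real.log η) x) ∂μ := by
        rw [integral_add (integrable_const _) ((integrable_const _).indicator hs),
          integral_indicator_const _ hs]
        simp only [integral_const, probReal_univ, one_mul, smul_eq_mul]
        exact add_le_add le_rfl
          (mul_le_mul_of_nonpos_right hreal (Real.log_nonpos hη.le hη1))
    _ ≤ _ := by
        refine integral_mono ((integrable_const _).add ((integrable_const _).indicator hs))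
          hw fun x => ?_
        by_cases hx : x ∈ s
        · simp only [Set.indicator_of_mem hx]
          have h1 : Real.log (1 - ε) ≤ 0 := Real.log_nonpos hε'.le (by linarith)
          have h2 : Real.log η ≤ Real.log (w x) := Real.log_le_log hη (hηw x)
          linarith
        · simp only [Set.indicator_of_notMem hx, add_zero]
          exact Real.log_le_log hε' (hsw x hx)

lemma lintegral_snd_compProd {X T K : Type*} [MeasurableSpace X] [MeasurableSpace T]
    [MeasurableSpace K] [DiscreteMeasurableSpace K] (κ : Kernel T X) [IsSFiniteKernel κ]
    (e : Kernel (X × T) K) [IsSFiniteKernel e] (t : T) (g : K → ℝ≥0∞) :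
    ∫⁻ k, g k ∂(Kernel.snd (κ ⊗ₖ e.comap Prod.swap measurable_swap)) t =
      ∫⁻ x, ∫⁻ k, g k ∂e (x, t) ∂κ t := by
  have hg : Measurable g := .of_discrete
  rw [Kernel.snd_apply, lintegral_map hg measurable_snd,
    Kernel.lintegral_compProd _ _ _ (by fun_prop)]
  rfl

namespace Protocol

variable {α β γ : Type} [MeasurableSpace α] [MeasurableSpace β] [MeasurableSpace γ] {n l m : ℕ}

instance (p : Protocol α β n l m) (P : Measure (α × β × γ)) [IsProbabilityMeasure P] :
    IsProbabilityMeasure (p.joint P) := by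
  unfold joint; infer_instance

/-- After the change of measure to independent observations, the two keys are independent
conditionally on the public messages, with conditional laws `A` and `B`. -/
lemma exists_condIndep_keys [StandardBorelSpace α] [Nonempty α] [StandardBorelSpace β]
    [Nonempty β] (p : Protocol α β n l m) (P : Measure (α × β × γ)) [IsProbabilityMeasure P]
    (μ : Measure α) (ν : Measure β) [IsProbabilityMeasure μ] [IsProbabilityMeasure ν]
    {h : α × β → ℝ} (hh : Measurable h) (hpos : ∀ z, 0 < h z)
    (hP : P.map (fun t => (t.1, t.2.1)) = (μ.prod ν).withDensity fun z => ENNReal.ofReal (h z)) :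
    ∃ (ρ : Measure (Fin (2 * l) → p.M)) (A B : Kernel (Fin (2 * l) → p.M) (Fin m)),
      IsProbabilityMeasure ρ ∧ IsMarkovKernel A ∧ IsMarkovKernel B ∧
      ∀ φ : (Fin (2 * l) → p.M) × (Fin m × Fin m) → ℝ≥0∞, Measurable φ →
        ∫⁻ t, φ (t.1.2, t.2) * (∏ i, ENNReal.ofReal (h ((t.1.1 i).1, (t.1.1 i).2.1)))⁻¹
            ∂p.joint P =
          ∫⁻ f, ∫⁻ k', ∫⁻ k, φ (f, (k, k')) ∂A f ∂B f ∂ρ := by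
  obtain ⟨ρ, κ, η, _, _, _, hρ⟩ := p.condIndepLaw_transcript (Measure.pi fun _ : Fin n => μ)
    (Measure.pi fun _ : Fin n => ν) (2 * l)
  refine ⟨ρ, Kernel.snd (κ ⊗ₖ p.keyA.comap Prod.swap measurable_swap),
    Kernel.snd (η ⊗ₖ p.keyB.comap Prod.swap measurable_swap), inferInstance, inferInstance,
    inferInstance, fun φ hφ => ?_⟩
  set ψ : ((Fin n → α) × (Fin n → β)) × (Fin (2 * l) → p.M) → ℝ≥0∞ := fun z =>
    ∫⁻ k, φ (z.2, k) ∂(p.keyA.comap (fun z : ((Fin n → α) × (Fin n → β)) × (Fin (2 * l) → p.M) =>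
      (z.1.1, z.2)) (by fun_prop) ×ₖ p.keyB.comap
        (fun z : ((Fin n → α) × (Fin n → β)) × (Fin (2 * l) → p.M) => (z.1.2, z.2))
          (by fun_prop)) z with hψ
  have hψm : Measurable ψ :=
    measurable_lintegral_kernel _ (g := fun z => z) measurable_id
      (f := fun q : (((Fin n → α) × (Fin n → β)) × (Fin (2 * l) → p.M)) × (Fin m × Fin m) =>
        φ (q.1.2, q.2)) (by fun_prop)
  have hχm : Measurable fun z => ∫⁻ f, ψ (z, f) ∂p.transcript (2 * l) z :=
    measurable_lintegral_kernel _ (g := fun z => z) measurable_id hψm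
  have hd : Measurable fun s : Fin n → α × β × γ =>
      (∏ i, ENNReal.ofReal (h ((s i).1, (s i).2.1)))⁻¹ := by fun_prop
  have hψ' : Measurable fun t : (Fin n → α × β × γ) × (Fin (2 * l) → p.M) =>
      ψ ((fun i => (t.1 i).1, fun i => (t.1 i).2.1), t.2) *
        (∏ i, ENNReal.ofReal (h ((t.1 i).1, (t.1 i).2.1)))⁻¹ :=
    (hψm.comp (by fun_prop)).mul (hd.comp measurable_fst)
  calc _ = ∫⁻ s, (∫⁻ f, ψ ((fun i => (s i).1, fun i => (s i).2.1), f)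
            ∂p.transcript (2 * l) (fun i => (s i).1, fun i => (s i).2.1)) *
          (∏ i, ENNReal.ofReal (h ((s i).1, (s i).2.1)))⁻¹ ∂(Measure.pi fun _ : Fin n => P) := by
        rw [joint, Measure.lintegral_compProd (by fun_prop)]
        have : ∀ t : (Fin n → α × β × γ) × (Fin (2 * l) → p.M), ∫⁻ k, φ (t.2, k) *
            (∏ i, ENNReal.ofReal (h ((t.1 i).1, (t.1 i).2.1)))⁻¹
              ∂((p.keyA.comap (fun t : (Fin n → α × β × γ) × (Fin (2 * l) → p.M) =>
                (fun i => (t.1 i).1, t.2)) (by fun_prop)) ×ₖ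
                (p.keyB.comap (fun t : (Fin n → α × β × γ) × (Fin (2 * l) → p.M) =>
                (fun i => (t.1 i).2.1, t.2)) (by fun_prop))) t =
            ψ ((fun i => (t.1 i).1, fun i => (t.1 i).2.1), t.2) *
              (∏ i, ENNReal.ofReal (h ((t.1 i).1, (t.1 i).2.1)))⁻¹ := fun t => by
          rw [lintegral_mul_const _ (by fun_prop), hψ]
          simp only [Kernel.prod_apply, Kernel.comap_apply]
        simp_rw [this]
        rw [Measure.lintegral_compProd hψ']
        refine lintegral_congr fun s => ?_
        rw [Kernel.comap_apply]
        dsimp only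
        exact lintegral_mul_const (f := fun b => ψ ((fun i => (s i).1, fun i => (s i).2.1), b)) _
          (hψm.comp (by fun_prop))
    _ = ∫⁻ z, ψ z ∂((Measure.pi fun _ : Fin n => μ).prod (Measure.pi fun _ : Fin n => ν) ⊗ₘ
          p.transcript (2 * l)) := by
        rw [Measure.lintegral_compProd hψm, ← lintegral_div_density P μ ν hh hpos hP hχm]
    _ = ∫⁻ f, ∫⁻ x, ∫⁻ y, ψ ((x, y), f) ∂η f ∂κ f ∂ρ := hρ ψ hψm
    _ = _ := by
        refine lintegral_congr fun f => ?_
        simp_rw [lintegral_snd_compProd]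
        have hψ2 : ∀ x y, ψ ((x, y), f) =
            ∫⁻ k', ∫⁻ k, φ (f, (k, k')) ∂p.keyA (x, f) ∂p.keyB (y, f) := fun x y => by
          rw [hψ]
          exact Kernel.lintegral_prod_symm _ _ _ (by fun_prop)
        simp_rw [hψ2]
        have h1 : Measurable fun q : ((Fin n → α) × (Fin n → β)) × Fin m =>
            ∫⁻ k, φ (f, (k, q.2)) ∂p.keyA (q.1.1, f) :=
          measurable_lintegral_kernel p.keyA
            (g := fun q : ((Fin n → α) × (Fin n → β)) × Fin m => (q.1.1, f)) (by fun_prop)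
            (f := fun q : (((Fin n → α) × (Fin n → β)) × Fin m) × Fin m => φ (f, (q.2, q.1.2)))
            (by fun_prop)
        have h2 : Measurable fun q : (Fin n → α) × Fin m =>
            ∫⁻ k, φ (f, (k, q.2)) ∂p.keyA (q.1, f) :=
          measurable_lintegral_kernel p.keyA (g := fun q : (Fin n → α) × Fin m => (q.1, f))
            (by fun_prop) (f := fun q : ((Fin n → α) × Fin m) × Fin m => φ (f, (q.2, q.1.2)))
            (by fun_prop)
        have h3 : Measurable fun z : (Fin n → α) × (Fin n → β) =>
            ∫⁻ k', ∫⁻ k, φ (f, (k, k')) ∂p.keyA (z.1, f) ∂p.keyB (z.2, f) :=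
          measurable_lintegral_kernel p.keyB
            (g := fun z : (Fin n → α) × (Fin n → β) => (z.2, f)) (by fun_prop) h1
        rw [lintegral_lintegral_swap h3.aemeasurable]
        exact lintegral_congr fun y => lintegral_lintegral_swap h2.aemeasurable

lemma map_joint_eval (p : Protocol α β n l m) (P : Measure (α × β × γ)) [IsProbabilityMeasure P]
    (i : Fin n) : (p.joint P).map (fun t => t.1.1 i) = P := by
  have h1 : (p.joint P).fst.fst = Measure.pi fun _ : Fin n => P := by
    rw [joint, Measure.fst_compProd, Measure.fst_compProd]
  calc _ = (p.joint P).fst.fst.map (Function.eval i) := by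
        rw [Measure.fst, Measure.fst, Measure.map_map (by fun_prop) (by fun_prop),
          Measure.map_map (by fun_prop) (by fun_prop)]
        rfl
    _ = P := by rw [h1, (measurePreserving_eval (fun _ : Fin n => P) i).map_eq]

/-- The information density of the block is additive over its letters. -/
lemma integral_log_prod_joint (p : Protocol α β n l m) (P : Measure (α × β × γ))
    [IsProbabilityMeasure P] {h : α × β → ℝ} (hh : Measurable h) {c C : ℝ} (hc : 0 < c)
    (hch : ∀ z, c ≤ h z) (hhC : ∀ z, h z ≤ C) :
    Integrable (fun t => Real.log (∏ i, h ((t.1.1 i).1, (t.1.1 i).2.1))) (p.joint P) ∧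
      ∫ t, Real.log (∏ i, h ((t.1.1 i).1, (t.1.1 i).2.1)) ∂p.joint P =
        n * ∫ t, Real.log (h (t.1, t.2.1)) ∂P := by
  have hh0 : ∀ z, 0 < h z := fun z => hc.trans_le (hch z)
  have hhb : ∀ z, ‖Real.log (h z)‖ ≤ max |Real.log c| |Real.log C| := fun z =>
    abs_le_max_abs_abs (Real.log_le_log hc (hch z)) (Real.log_le_log (hh0 z) (hhC z))
  have hhi : ∀ i, Integrable (fun t => Real.log (h ((t.1.1 i).1, (t.1.1 i).2.1))) (p.joint P) :=
    fun i => .of_bound (Measurable.aestronglyMeasurable (by fun_prop)) _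
      (.of_forall fun t => hhb _)
  have hprod : ∀ s : Fin n → α × β × γ, Real.log (∏ i, h ((s i).1, (s i).2.1)) =
      ∑ i, Real.log (h ((s i).1, (s i).2.1)) := fun s =>
    Real.log_prod fun i _ => (hh0 _).ne'
  simp_rw [hprod]
  refine ⟨integrable_finsetSum _ fun i _ => hhi i, ?_⟩
  rw [integral_finsetSum _ fun i _ => hhi i]
  have hi : ∀ i, ∫ t, Real.log (h ((t.1.1 i).1, (t.1.1 i).2.1)) ∂p.joint P =
      ∫ t, Real.log (h (t.1, t.2.1)) ∂P := fun i => by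
    conv_rhs => rw [← p.map_joint_eval P i]
    rw [integral_map (by fun_prop) (Measurable.aestronglyMeasurable (by fun_prop))]
  simp [hi]

/-- Agreement on a key that is unpredictable from the public messages needs observations with
large mutual information `∫ log h`. Here `a` is the conditional law of Alice's key given the
messages for independent observations, mixed with a small uniform part, so that `log a` is bounded. -/
lemma exists_log_le [StandardBorelSpace α] [Nonempty α] [StandardBorelSpace β]
    [Nonempty β] (p : Protocol α β n l m) (P : Measure (α × β × γ)) [IsProbabilityMeasure P]
    (μ : Measure α) (ν : Measure β) [IsProbabilityMeasure μ] [IsProbabilityMeasure ν]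
    {h : α × β → ℝ} (hh : Measurable h) {c C : ℝ} (hc : 0 < c) (hch : ∀ z, c ≤ h z)
    (hhC : ∀ z, h z ≤ C)
    (hP : P.map (fun t => (t.1, t.2.1)) = (μ.prod ν).withDensity fun z => ENNReal.ofReal (h z))
    (hm : 1 ≤ m) {ε : ℝ} (hε : 0 < ε) (hε1 : ε < 1)
    (herr : p.joint P {t | t.2.1 ≠ t.2.2} ≤ ENNReal.ofReal ε) :
    ∃ a : Fin m × (Fin (2 * l) → p.M) → ℝ, Measurable a ∧ (∀ z, ε / m ≤ a z) ∧
      (∀ v, ∑ k, a (k, v) ≤ 1) ∧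
      2 * Real.log (1 - ε) + ε * Real.log (ε / m) ≤
        ∫ t, Real.log (a (t.2.1, t.1.2)) ∂p.joint P + n * ∫ t, Real.log (h (t.1, t.2.1)) ∂P := by
  have hm0 : (0 : ℝ) < m := by exact_mod_cast hm
  have hε' : 0 < 1 - ε := by linarith
  have hεm : 0 < ε / m := by positivity
  have hεm1 : ε / m ≤ 1 := (div_le_one hm0).2 (hε1.le.trans (by exact_mod_cast hm))
  obtain ⟨ρ, A, B, _, _, _, hρ⟩ :=
    p.exists_condIndep_keys P μ ν hh (fun z => hc.trans_le (hch z)) hP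
  set a : Fin m × (Fin (2 * l) → p.M) → ℝ := fun z => (1 - ε) * (A z.2).real {z.1} + ε / m with ha
  set W : Fin m × Fin m → ℝ := fun k => (if k.1 = k.2 then 1 - ε else 0) + ε / m with hW
  have ham : Measurable a := by
    refine measurable_from_prod_countable_right fun k => ?_
    exact ((A.measurable_coe (measurableSet_singleton k)).ennreal_toReal.const_mul _).add_const _
  have haε : ∀ z, ε / m ≤ a z := fun z =>
    le_add_of_nonneg_left (mul_nonneg hε'.le measureReal_nonneg)
  have ha0 : ∀ z, 0 < a z := fun z => hεm.trans_le (haε z)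
  have hsum : ∀ v, ∑ k, a (k, v) = 1 := fun v => by
    simp only [ha]
    rw [Finset.sum_add_distrib, ← Finset.mul_sum, sum_measureReal_singleton]
    simp
    field_simp
    ring
  have ha1 : ∀ z, a z ≤ 1 := fun z =>
    (Finset.single_le_sum (f := fun k => a (k, z.2)) (fun k _ => (ha0 _).le)
      (Finset.mem_univ z.1)).trans (hsum z.2).le
  have hWε : ∀ k, ε / m ≤ W k := fun k =>
    le_add_of_nonneg_left (by split_ifs <;> linarith)
  have hW0 : ∀ k, 0 < W k := fun k => hεm.trans_le (hWε k)
  have hWsum : ∀ k', ∑ k, W (k, k') = 1 := fun k' => by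
    simp only [hW]
    rw [Finset.sum_add_distrib, Finset.sum_ite_eq' Finset.univ k' fun _ => 1 - ε]
    simp
    field_simp
    ring
  have hW1 : ∀ k, W k ≤ 1 := fun k =>
    (Finset.single_le_sum (f := fun j => W (j, k.2)) (fun k _ => (hW0 _).le)
      (Finset.mem_univ k.1)).trans (hWsum k.2).le
  have hh0 : ∀ z, 0 < h z := fun z => hc.trans_le (hch z)
  set L : (Fin n → α × β × γ) → ℝ := fun s => ∏ i, h ((s i).1, (s i).2.1) with hL
  have hL0 : ∀ s, 0 < L s := fun s => Finset.prod_pos fun i _ => hh0 _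
  have hLm : Measurable L := by fun_prop
  set u : ((Fin n → α × β × γ) × (Fin (2 * l) → p.M)) × (Fin m × Fin m) → ℝ :=
    fun t => W t.2 / a (t.2.1, t.1.2) * (L t.1.1)⁻¹ with hu
  have hu0 : ∀ t, 0 < u t := fun t =>
    mul_pos (div_pos (hW0 _) (ha0 _)) (inv_pos.2 (hL0 _))
  have hWm : Measurable W := .of_discrete
  have hum : Measurable u := by fun_prop
  -- For independent observations the expectation of `W / a` is at most `1 / (1 - ε)`.
  have hlu : ∫⁻ t, ENNReal.ofReal (u t) ∂p.joint P ≤ ENNReal.ofReal (1 - ε)⁻¹ := by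
    have hφ := hρ (fun q => ENNReal.ofReal (W q.2 / a (q.2.1, q.1))) (by fun_prop)
    have : ∀ t, ENNReal.ofReal (u t) = ENNReal.ofReal (W t.2 / a (t.2.1, t.1.2)) *
        (∏ i, ENNReal.ofReal (h ((t.1.1 i).1, (t.1.1 i).2.1)))⁻¹ := fun t => by
      rw [hu, ENNReal.ofReal_mul (div_pos (hW0 _) (ha0 _)).le, ENNReal.ofReal_inv_of_pos (hL0 _),
        ENNReal.ofReal_prod_of_nonneg fun i _ => (hh0 _).le]
    simp_rw [this]
    rw [hφ]
    have hin : ∀ f k', ∫⁻ k, ENNReal.ofReal (W (k, k') / a (k, f)) ∂A f ≤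
        ENNReal.ofReal (1 - ε)⁻¹ := fun f k' => by
      rw [lintegral_fintype]
      calc _ ≤ ∑ k, ENNReal.ofReal (W (k, k') * (1 - ε)⁻¹) := by
            refine Finset.sum_le_sum fun k _ => ?_
            rw [← ofReal_measureReal, ← ENNReal.ofReal_mul (div_pos (hW0 _) (ha0 _)).le]
            refine ENNReal.ofReal_le_ofReal ?_
            rw [div_mul_eq_mul_div, mul_div_assoc]
            refine mul_le_mul_of_nonneg_left ?_ (hW0 _).le
            rw [div_le_iff₀ (ha0 _), inv_mul_eq_div, le_div_iff₀ hε', mul_comm]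
            exact le_add_of_nonneg_right hεm.le
        _ = _ := by
            rw [← ENNReal.ofReal_sum_of_nonneg fun k _ =>
              mul_nonneg (hW0 _).le (inv_pos.2 hε').le, ← Finset.sum_mul, hWsum, one_mul]
    calc _ ≤ ∫⁻ f, ∫⁻ _, ENNReal.ofReal (1 - ε)⁻¹ ∂B f ∂ρ :=
          lintegral_mono fun f => lintegral_mono fun k' => hin f k'
      _ = _ := by simp
  have hlogx : ∀ x : ℝ, ε / m ≤ x → x ≤ 1 → ‖Real.log x‖ ≤ -Real.log (ε / m) := fun x h1 h2 => by
    rw [Real.norm_of_nonpos (Real.log_nonpos (hεm.le.trans h1) h2)]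
    exact neg_le_neg (Real.log_le_log hεm h1)
  have hWi : Integrable (fun t => Real.log (W t.2)) (p.joint P) :=
    .of_bound (Measurable.aestronglyMeasurable (by fun_prop)) _
      (.of_forall fun t => hlogx _ (hWε _) (hW1 _))
  have hai : Integrable (fun t => Real.log (a (t.2.1, t.1.2))) (p.joint P) :=
    .of_bound (Measurable.aestronglyMeasurable (by fun_prop)) _
      (.of_forall fun t => hlogx _ (haε _) (ha1 _))
  have hWai : Integrable (fun t => Real.log (W t.2) - Real.log (a (t.2.1, t.1.2))) (p.joint P) :=
    hWi.sub hai
  obtain ⟨hLi, hLint⟩ := p.integral_log_prod_joint P hh hc hch hhC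
  have hlogu : ∀ t, Real.log (u t) =
      Real.log (W t.2) - Real.log (a (t.2.1, t.1.2)) - Real.log (L t.1.1) := fun t => by
    rw [hu, Real.log_mul (div_pos (hW0 _) (ha0 _)).ne' (inv_pos.2 (hL0 _)).ne',
      Real.log_div (hW0 _).ne' (ha0 _).ne', Real.log_inv, ← sub_eq_add_neg]
  have hJ := integral_log_le_of_lintegral_le hum hu0
    (by simp_rw [hlogu]; exact hWai.sub hLi) hε' hlu
  simp_rw [hlogu] at hJ
  rw [integral_sub hWai hLi, integral_sub hWi hai, hLint] at hJ
  have hset : MeasurableSet {t : ((Fin n → α × β × γ) × (Fin (2 * l) → p.M)) × (Fin m × Fin m) |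
      t.2.1 ≠ t.2.2} :=
    measurable_snd (MeasurableSet.of_discrete (s := {k : Fin m × Fin m | k.1 ≠ k.2}))
  have hF := log_add_le_integral_log hset hε hε1 hεm hεm1 herr hWi (fun t => hWε _) fun t ht => by
    have ht : t.2.1 = t.2.2 := not_not.1 ht
    simp only [hW, ht, if_true]
    linarith
  exact ⟨a, ham, haε, fun v => (hsum v).le, by linarith⟩

end Protocol

/-! ### The converse bound -/

section Converse

variable {α β γ : Type} [MeasurableSpace α] [MeasurableSpace β] [MeasurableSpace γ]

lemma Protocol.fst_lawKeyAEve {n l m : ℕ} (p : Protocol α β n l m) (P : Measure (α × β × γ))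
    [SigmaFinite P] : (p.lawKeyAEve P).fst = p.lawKeyA P := by
  rw [lawKeyAEve, lawKeyA, Measure.fst, Measure.map_map (by fun_prop) (by fun_prop)]
  rfl

open Filter Topology in
/-- The rate of a secret key does not exceed the mutual information `∫ log h` of the observations of
Alice and Bob, where `h` is the density of their joint law with respect to a product law. -/
theorem IsAchievable.le_integral_log [StandardBorelSpace α] [Nonempty α] [StandardBorelSpace β]
    [Nonempty β] (P : Measure (α × β × γ)) [IsProbabilityMeasure P]
    (μ : Measure α) (ν : Measure β) [IsProbabilityMeasure μ] [IsProbabilityMeasure ν]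
    {h : α × β → ℝ} (hh : Measurable h) {c C : ℝ} (hc : 0 < c) (hch : ∀ z, c ≤ h z)
    (hhC : ∀ z, h z ≤ C)
    (hP : P.map (fun t => (t.1, t.2.1)) = (μ.prod ν).withDensity fun z => ENNReal.ofReal (h z))
    {S : ℝ} (hS : IsAchievable P S) : S ≤ ∫ t, Real.log (h (t.1, t.2.1)) ∂P := by
  set D := ∫ t, Real.log (h (t.1, t.2.1)) ∂P with hD
  have main : ∀ δ : ℝ, 0 < δ → δ < 1 →
      S * (1 - δ) - D ≤ 2 * δ - δ * Real.log δ - 2 * Real.log (1 - δ) := by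
    intro δ hδ hδ1
    obtain ⟨n, l, m, p, hn, -, hSm, herr, hent, hmi⟩ := hS δ hδ
    have hm : 1 ≤ m := by
      have : IsProbabilityMeasure (p.lawKeyA P) := Measure.isProbabilityMeasure_map (by fun_prop)
      obtain ⟨k⟩ := (p.lawKeyA P).nonempty_of_neZero
      exact k.pos
    have hn' : (1 : ℝ) ≤ n := by exact_mod_cast hn
    have hm0 : (0 : ℝ) < m := by exact_mod_cast hm
    have hlog : Real.log m = n * S := by rw [hSm]; field_simp
    obtain ⟨a, ham, haε, hsum, hmain⟩ := p.exists_log_le P μ ν hh hc hch hhC hP hm hδ hδ1 herr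
    have : IsProbabilityMeasure (p.lawKeyAEve P) := Measure.isProbabilityMeasure_map (by fun_prop)
    have hsec := integral_log_add_entropy_le (p.lawKeyAEve P) hδ.le hmi
      (a := fun z => a (z.1, z.2.1)) (by fun_prop) (div_pos hδ hm0) (fun z => haε _)
      (fun v => hsum v.1)
    rw [p.fst_lawKeyAEve, Protocol.lawKeyAEve, integral_map (by fun_prop)
      (Measurable.aestronglyMeasurable (by fun_prop))] at hsec
    rw [Real.log_div hδ.ne' hm0.ne', hlog, ← hD] at hmain
    have h1 : n * (S * (1 - δ) - D) ≤ 2 * δ - δ * Real.log δ - 2 * Real.log (1 - δ) := by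
      linarith
    have h2 : Real.log δ ≤ 0 := Real.log_nonpos hδ.le hδ1.le
    have h3 : Real.log (1 - δ) ≤ 0 := Real.log_nonpos (by linarith) (by linarith)
    rcases le_total (S * (1 - δ) - D) 0 with h0 | h0
    · nlinarith
    · exact (le_mul_of_one_le_left h0 hn').trans h1
  have hl : Tendsto (fun δ : ℝ => S * (1 - δ) - D) (𝓝[>] 0) (𝓝 (S - D)) := by
    have : Continuous fun δ : ℝ => S * (1 - δ) - D := by fun_prop
    simpa using (this.tendsto 0).mono_left nhdsWithin_le_nhds
  have hr : Tendsto (fun δ : ℝ => 2 * δ - δ * Real.log δ - 2 * Real.log (1 - δ)) (𝓝[>] 0)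
      (𝓝 0) := by
    have : ContinuousAt (fun δ : ℝ => 2 * δ - δ * Real.log δ - 2 * Real.log (1 - δ)) 0 := by
      refine ((continuousAt_id.const_mul 2).sub Real.continuous_mul_log.continuousAt).sub
        (ContinuousAt.const_mul (ContinuousAt.log (by fun_prop) (by norm_num)) 2)
    simpa using this.tendsto.mono_left nhdsWithin_le_nhds
  have := le_of_tendsto_of_tendsto hl hr (by
    filter_upwards [Ioo_mem_nhdsGT (zero_lt_one' ℝ)] with δ hδ using main δ hδ.1 hδ.2)
  linarith

end Converse

/-! ### The satellite source -/

/-- Probability that the quantized sum of the signal `w` and a Gaussian noise of variance `Q` is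
`w`. -/
def detectProb (w Q : ℝ) : ℝ := (gaussianReal 0 Q.toNNReal).real (Set.Ici (-w))

/-- The correlation coefficient of the quantized observations of Alice and Bob. -/
def quantCorr (w Q : ℝ) : ℝ := (2 * detectProb w Q - 1) ^ 2

/-- The density of the law of `(X_q, Y_q)` with respect to the product of its marginals. It depends
on the signs of its arguments only, so that it is bounded away from `0` everywhere if the correlation
is less than `1`. -/
def quantDensity (w Q : ℝ) (z : ℝ × ℝ) : ℝ := 1 + quantCorr w Q * quantize 1 z.1 * quantize 1 z.2

lemma measurable_quantDensity (w Q : ℝ) : Measurable (quantDensity w Q) := by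
  have := measurable_quantize 1
  unfold quantDensity
  fun_prop

lemma detectProb_le_one (w Q : ℝ) : detectProb w Q ≤ 1 := measureReal_le_one

lemma detectProb_nonneg (w Q : ℝ) : 0 ≤ detectProb w Q := measureReal_nonneg

/-- By the symmetry of the noise, this is also the probability of `w` when the satellite sends
`-w`. -/
lemma gaussianReal_Ici {w Q : ℝ} (hQ : 0 < Q) :
    (gaussianReal 0 Q.toNNReal).real (Set.Ici w) = 1 - detectProb w Q := by
  have : NullSingletonClass (gaussianReal 0 Q.toNNReal) :=
    nullSingletonClass_gaussianReal (by simpa using hQ)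
  rw [detectProb, ← probReal_compl_eq_one_sub measurableSet_Ici, Set.compl_Ici]
  have h : gaussianReal 0 Q.toNNReal = (gaussianReal 0 Q.toNNReal).map fun x => -x := by
    rw [gaussianReal_map_neg, neg_zero]
  rw [h, map_measureReal_apply measurable_neg measurableSet_Ici, ← h, measureReal_def,
    measureReal_def, measure_congr Iio_ae_eq_Iic]
  congr 2
  ext x
  simp

lemma quantCorr_le {w Q : ℝ} (hw : 0 < w) (hQ : 0 < Q) : quantCorr w Q ≤ w ^ 2 / Q := by
  have h1 : 2 * detectProb w Q - 1 = (gaussianReal 0 Q.toNNReal).real (Set.Ico (-w) w) := by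
    have h2 := gaussianReal_Ici (w := w) hQ
    have h3 : Set.Ici (-w) = Set.Ico (-w) w ∪ Set.Ici w :=
      (Set.Ico_union_Ici_eq_Ici (by linarith)).symm
    have h4 := measureReal_union (μ := gaussianReal 0 Q.toNNReal) (s₁ := Set.Ico (-w) w)
      (s₂ := Set.Ici w) ((Set.Iio_disjoint_Ici le_rfl).mono_left Set.Ico_subset_Iio_self)
      measurableSet_Ici
    rw [← h3] at h4
    change detectProb w Q = _ at h4
    linarith
  have hpi : 0 < 2 * Real.pi * Q := by positivity
  have h5 : 2 * detectProb w Q - 1 ≤ (√(2 * Real.pi * Q))⁻¹ * (2 * w) := by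
    rw [h1]
    refine ENNReal.toReal_le_of_le_ofReal (by positivity) ?_
    rw [gaussianReal_apply _ (by simpa using hQ)]
    calc _ ≤ ∫⁻ _ in Set.Ico (-w) w, ENNReal.ofReal (√(2 * Real.pi * Q))⁻¹ := by
          refine lintegral_mono fun x => ENNReal.ofReal_le_ofReal ?_
          rw [gaussianPDFReal_def, Real.coe_toNNReal _ hQ.le]
          refine mul_le_of_le_one_right (by positivity) (Real.exp_le_one_iff.2 ?_)
          exact div_nonpos_of_nonpos_of_nonneg (neg_nonpos.2 (sq_nonneg _)) (by positivity)
      _ = _ := by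
          rw [setLIntegral_const, Real.volume_Ico, ENNReal.ofReal_mul (by positivity)]
          ring_nf
  have h6 : 0 ≤ 2 * detectProb w Q - 1 := h1 ▸ measureReal_nonneg
  calc quantCorr w Q ≤ ((√(2 * Real.pi * Q))⁻¹ * (2 * w)) ^ 2 := pow_le_pow_left₀ h6 h5 2
    _ = 4 * w ^ 2 / (2 * Real.pi * Q) := by
        rw [mul_pow, inv_pow, Real.sq_sqrt hpi.le]; ring
    _ ≤ w ^ 2 / Q := by
        rw [div_le_div_iff₀ hpi hQ]
        nlinarith [Real.pi_gt_three, mul_pos (pow_pos hw 2) hQ]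

lemma quantCorr_nonneg (w Q : ℝ) : 0 ≤ quantCorr w Q := sq_nonneg _

lemma lintegral_satelliteLaw (w : ℝ) (f : ℝ → ℝ≥0∞) :
    ∫⁻ x, f x ∂satelliteLaw w = 2⁻¹ * f w + 2⁻¹ * f (-w) := by
  simp [satelliteLaw]

lemma integral_satelliteLaw (w : ℝ) (f : ℝ → ℝ) :
    ∫ x, f x ∂satelliteLaw w = (f w + f (-w)) / 2 := by
  rw [satelliteLaw, integral_add_measure ((integrable_dirac (by simp)).smul_measure (by simp))
    ((integrable_dirac (by simp)).smul_measure (by simp))]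
  simp
  ring

/-- The law of one quantized observation, given that the satellite sends `r`. -/
lemma lintegral_quantize (w Q r : ℝ) (f : ℝ → ℝ≥0∞) :
    ∫⁻ x, f (quantize w (r + x)) ∂gaussianReal 0 Q.toNNReal =
      ENNReal.ofReal ((gaussianReal 0 Q.toNNReal).real (Set.Ici (-r))) * f w +
        ENNReal.ofReal (1 - (gaussianReal 0 Q.toNNReal).real (Set.Ici (-r))) * f (-w) := by
  rw [← probReal_compl_eq_one_sub measurableSet_Ici, ofReal_measureReal, ofReal_measureReal,
    ← lintegral_add_compl _ (measurableSet_Ici (a := -r)),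
    setLIntegral_congr_fun measurableSet_Ici (g := fun _ => f w),
    setLIntegral_congr_fun measurableSet_Ici.compl (g := fun _ => f (-w)),
    setLIntegral_const, setLIntegral_const, mul_comm, mul_comm (f (-w))]
  · intro x hx
    have : r + x < 0 := by simp at hx; linarith
    simp [quantize, this]
  · intro x hx
    have : ¬ r + x < 0 := by simp at hx; linarith
    simp [quantize, this]

lemma map_satelliteSource {w Q : ℝ} (hw : 0 < w) (hQ : 0 < Q) :
    (satelliteSource w Q).map (fun t => (t.1, t.2.1)) =
      ((satelliteLaw w).prod (satelliteLaw w)).withDensity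
        fun z => ENNReal.ofReal (quantDensity w Q z) := by
  have hqm := measurable_quantize w
  refine Measure.ext_of_lintegral _ fun f hf => ?_
  have hp0 := detectProb_nonneg w Q
  have hp1 : 0 ≤ 1 - detectProb w Q := sub_nonneg.2 (detectProb_le_one w Q)
  have hρ0 := quantCorr_nonneg w Q
  set p := detectProb w Q with hp
  set ρ := quantCorr w Q with hρdef
  have hρp : ρ = (2 * p - 1) ^ 2 := rfl
  have h2 : (2⁻¹ : ℝ≥0∞) = ENNReal.ofReal 2⁻¹ := by
    rw [ENNReal.ofReal_inv_of_pos two_pos, ENNReal.ofReal_ofNat]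
  have e1 : 2⁻¹ * (ENNReal.ofReal p * ENNReal.ofReal p) +
      2⁻¹ * (ENNReal.ofReal (1 - p) * ENNReal.ofReal (1 - p)) =
      2⁻¹ * 2⁻¹ * ENNReal.ofReal (1 + ρ) := by
    rw [h2, ← ENNReal.ofReal_mul hp0, ← ENNReal.ofReal_mul hp1,
      ← ENNReal.ofReal_mul (by positivity), ← ENNReal.ofReal_mul (by positivity),
      ← ENNReal.ofReal_mul (by positivity), ← ENNReal.ofReal_mul (by positivity),
      ← ENNReal.ofReal_add (by positivity) (by positivity), hρp]
    ring_nf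
  have e2 : 2⁻¹ * (ENNReal.ofReal p * ENNReal.ofReal (1 - p)) +
      2⁻¹ * (ENNReal.ofReal (1 - p) * ENNReal.ofReal p) =
      2⁻¹ * 2⁻¹ * ENNReal.ofReal (1 - ρ) := by
    rw [h2, ← ENNReal.ofReal_mul hp0, ← ENNReal.ofReal_mul hp1,
      ← ENNReal.ofReal_mul (by positivity), ← ENNReal.ofReal_mul (by positivity),
      ← ENNReal.ofReal_mul (by positivity), ← ENNReal.ofReal_mul (by positivity),
      ← ENNReal.ofReal_add (by positivity) (by positivity), hρp]
    ring_nf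
  have hq1 : quantize 1 w = 1 := by simp [quantize, hw.le]
  have hq2 : quantize 1 (-w) = -1 := by simp [quantize, hw]
  have hl1 : (gaussianReal 0 Q.toNNReal).real (Set.Ici (-w)) = p := rfl
  have hl2 : (gaussianReal 0 Q.toNNReal).real (Set.Ici (- -w)) = 1 - p := by
    rw [neg_neg]; exact gaussianReal_Ici hQ
  have hqd := measurable_quantDensity w Q
  calc ∫⁻ z, f z ∂_ = ∫⁻ t, f (quantize w (t.1 + t.2.1), quantize w (t.1 + t.2.2.1))
        ∂inputLaw w Q := by
        rw [lintegral_map hf (by fun_prop), satelliteSource, lintegral_map (by fun_prop)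
          (by fun_prop)]
    _ = ∫⁻ r, ∫⁻ x, ∫⁻ y, f (quantize w (r + x), quantize w (r + y))
          ∂gaussianReal 0 Q.toNNReal ∂gaussianReal 0 Q.toNNReal ∂satelliteLaw w := by
        rw [inputLaw, lintegral_prod _ (Measurable.aemeasurable (by fun_prop))]
        refine lintegral_congr fun r => ?_
        rw [lintegral_prod _ (Measurable.aemeasurable (by fun_prop))]
        refine lintegral_congr fun x => ?_
        rw [lintegral_prod _ (Measurable.aemeasurable (by fun_prop))]
        simp
    _ = (2⁻¹ * (ENNReal.ofReal p * ENNReal.ofReal p) +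
          2⁻¹ * (ENNReal.ofReal (1 - p) * ENNReal.ofReal (1 - p))) * (f (w, w) + f (-w, -w)) +
        (2⁻¹ * (ENNReal.ofReal p * ENNReal.ofReal (1 - p)) +
          2⁻¹ * (ENNReal.ofReal (1 - p) * ENNReal.ofReal p)) * (f (w, -w) + f (-w, w)) := by
        rw [lintegral_satelliteLaw]
        simp_rw [fun r x => lintegral_quantize w Q r fun y => f (quantize w (r + x), y)]
        rw [lintegral_quantize w Q w fun x => ENNReal.ofReal _ * f (x, w) +
            ENNReal.ofReal _ * f (x, -w),
          lintegral_quantize w Q (-w) fun x => ENNReal.ofReal _ * f (x, w) +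
            ENNReal.ofReal _ * f (x, -w), hl1, hl2, sub_sub_cancel]
        ring
    _ = _ := by
        rw [e1, e2, lintegral_withDensity_eq_lintegral_mul _ (by fun_prop) hf,
          lintegral_prod _ (Measurable.aemeasurable (by fun_prop))]
        simp only [lintegral_satelliteLaw, Pi.mul_apply, quantDensity, hq1, hq2, mul_one,
          mul_neg, ← sub_eq_add_neg]
        rw [← hρdef]
        ring_nf

lemma quantDensity_mem {w Q : ℝ} (hρ : quantCorr w Q ≤ 1 / 2) (z : ℝ × ℝ) :
    1 / 2 ≤ quantDensity w Q z ∧ quantDensity w Q z ≤ 2 := by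
  have := quantCorr_nonneg w Q
  unfold quantDensity quantize
  split_ifs <;> constructor <;> linarith

/-- Small correlation `ρ` means mutual information at most `ρ ^ 2`: the mean of `log h` is at most
the mean of `h - 1`. -/
lemma integral_log_quantDensity_le {w Q : ℝ} (hw : 0 < w) (hQ : 0 < Q)
    (hρ : quantCorr w Q ≤ 1 / 2) :
    ∫ t, Real.log (quantDensity w Q (t.1, t.2.1)) ∂satelliteSource w Q ≤ quantCorr w Q ^ 2 := by
  have hqd := measurable_quantDensity w Q
  have hmem := quantDensity_mem hρ
  have hpos : ∀ z, 0 < quantDensity w Q z := fun z => one_half_pos.trans_le (hmem z).1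
  have hq1 : quantize 1 w = 1 := by simp [quantize, hw.le]
  have hq2 : quantize 1 (-w) = -1 := by simp [quantize, hw]
  have hlog : Integrable (fun t : ℝ × ℝ × ℝ => Real.log (quantDensity w Q (t.1, t.2.1)))
      (satelliteSource w Q) := by
    refine .of_bound (Measurable.aestronglyMeasurable (by fun_prop))
      (max |Real.log (1 / 2)| |Real.log 2|) (.of_forall fun t => ?_)
    exact abs_le_max_abs_abs (Real.log_le_log one_half_pos (hmem _).1)
      (Real.log_le_log (hpos _) (hmem _).2)
  have hsub : Integrable (fun t : ℝ × ℝ × ℝ => quantDensity w Q (t.1, t.2.1) - 1)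
      (satelliteSource w Q) := by
    refine .of_bound (Measurable.aestronglyMeasurable (by fun_prop)) 1 (.of_forall fun t => ?_)
    have := hmem (t.1, t.2.1)
    exact abs_le.2 ⟨by linarith, by linarith⟩
  have hprod : Integrable (fun z => quantDensity w Q z * (quantDensity w Q z - 1))
      ((satelliteLaw w).prod (satelliteLaw w)) := by
    refine .of_bound (Measurable.aestronglyMeasurable (by fun_prop)) 2 (.of_forall fun z => ?_)
    have := hmem z
    exact abs_le.2 ⟨by nlinarith, by nlinarith⟩
  calc _ ≤ ∫ t, (quantDensity w Q (t.1, t.2.1) - 1) ∂satelliteSource w Q :=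
        integral_mono hlog hsub fun t => Real.log_le_sub_one_of_pos (hpos _)
    _ = ∫ z, (quantDensity w Q z - 1) ∂(satelliteSource w Q).map fun t => (t.1, t.2.1) := by
        rw [integral_map (by fun_prop) (Measurable.aestronglyMeasurable (by fun_prop))]
    _ = ∫ z, quantDensity w Q z * (quantDensity w Q z - 1)
          ∂(satelliteLaw w).prod (satelliteLaw w) := by
        rw [map_satelliteSource hw hQ, integral_withDensity_eq_integral_toReal_smul
          (by fun_prop) (.of_forall fun _ => ENNReal.ofReal_lt_top)]
        simp only [ENNReal.toReal_ofReal (hpos _).le, smul_eq_mul]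
    _ = quantCorr w Q ^ 2 := by
        rw [integral_prod _ hprod]
        simp only [integral_satelliteLaw, quantDensity, hq1, hq2]
        ring

/-- The secret-key capacity of the satellite source is at most `w ^ 4 / Q ^ 2`, already without
using that Eve has the observation `Z^n`. -/
lemma capacity_satelliteSource_le {w Q : ℝ} (hw : 0 < w) (hQ : 0 < Q) (hwQ : w ^ 2 / Q ≤ 1 / 2) :
    capacity (satelliteSource w Q) ≤ ENNReal.ofReal (w ^ 4 / Q ^ 2) := by
  have hρ := (quantCorr_le hw hQ).trans hwQ
  refine iSup₂_le fun S hS => ENNReal.ofReal_le_ofReal ?_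
  calc S ≤ _ := hS.le_integral_log _ _ _ (measurable_quantDensity w Q) one_half_pos
        (fun z => (quantDensity_mem hρ z).1) (fun z => (quantDensity_mem hρ z).2)
        (map_satelliteSource hw hQ)
    _ ≤ quantCorr w Q ^ 2 := integral_log_quantDensity_le hw hQ hρ
    _ ≤ (w ^ 2 / Q) ^ 2 := pow_le_pow_left₀ (quantCorr_nonneg w Q) (quantCorr_le hw hQ) 2
    _ = w ^ 4 / Q ^ 2 := by rw [div_pow, ← pow_mul]

end SecretKey

end
theorem corollary1 (W : Set ℝ) (hne : W.Nonempty) (hpos : W ⊆ Set.Ioi 0)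
    (hbdd : Bornology.IsBounded W) :
    ∃ C : ℝ, 0 < C ∧ ∃ Q₀ : ℝ, 1 < Q₀ ∧ ∀ Q : ℝ, Q₀ ≤ Q →
      SecretKey.satelliteCapacity W Q ≤ ENNReal.ofReal (C / Q ^ 2) := by
  obtain ⟨B, hB⟩ := hbdd.exists_norm_le
  have hwB : ∀ w ∈ W, 0 < w ∧ w ≤ B := fun w hw => ⟨hpos hw, (le_abs_self w).trans (hB w hw)⟩
  refine ⟨B ^ 4 + 1, by positivity, 2 * B ^ 2 + 2, by nlinarith [sq_nonneg B], fun Q hQ => ?_⟩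
  have hQ0 : 0 < Q := by nlinarith [sq_nonneg B]
  refine iSup₂_le fun w hw => ?_
  obtain ⟨h0, h1⟩ := hwB w hw
  refine (SecretKey.capacity_satelliteSource_le h0 hQ0 ?_).trans (ENNReal.ofReal_le_ofReal ?_)
  · rw [div_le_iff₀ hQ0]
    nlinarith [pow_le_pow_left₀ h0.le h1 2]
  · gcongr
    linarith [pow_le_pow_left₀ h0.le h1 4]
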